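/- For a finite group $G$ let $Z^2(G,\mathbb{C}^\times)$ be the group of $2$-cocycles of $G$ with values in the trivial $G$-module $\mathbb{C}^\times$, and $\mathrm{H}^2(G,\mathbb{C}^\times)$ its quotient by the $2$-coboundaries. For $\alpha\in Z^2(G,\mathbb{C}^\times)$ the twisted group ring $\mathbb{C}^\alpha G$ is the $\mathbb{C}$-vector space with basis $\{\bar g : g\in G\}$ and the bilinear multiplication given by $\bar g\,\bar h=\alpha(g,h)\,\overline{gh}$; up to isomorphism it depends only on the class $[\alpha]$. Write $G\sim_{\mathbb{C}}H$ if there is a group isomorphism $\phi:\mathrm{H}^2(G,\mathbb{C}^\times)\to\mathrm{H}^2(H,\mathbb{C}^\times)$ such that $\mathbb{C}^\alpha G\cong\mathbb{C}^{\phi(\alpha)}H$ as rings for every $[\alpha]\in\mathrm{H}^2(G,\mathbb{C}^\times)$. **Theorem 1.3.** (a) Let $G=G_1\times\cdots\times G_r$ and $H=H_1\times\cdots\times H_r$, where the $G_i$ and $H_i$ are finite groups with $|G_i|=|H_i|=k_i$ for each $i$, and $\gcd(k_i,k_j)=1$ for $i\neq j$. Then $G\sim_{\mathbb{C}}H$ if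 and only if $G_i\sim_{\mathbb{C}}H_i$ for every $i=1,\dots,r$. (b) Consequently, let $G$ and $H$ be finite nilpotent groups of the same order. Then $G\sim_{\mathbb{C}}H$ if and only if, for every prime $p$, every Sylow $p$-subgroup $P$ of $G$ and every Sylow $p$-subgroup $Q$ of $H$ satisfy $P\sim_{\mathbb{C}}Q$. -/

import Mathlib

noncomputable section

/-- The group `Z²(G, Rˣ)` of 2-cocycles of `G` with values in the trivial `G`-module `Rˣ`. -/
def twoCocycles (R : Type*) [CommRing R] (G : Type*) [Group G] : Subgroup (G → G → Rˣ) where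
  carrier := {α | ∀ g h j : G, α g h * α (g * h) j = α h j * α g (h * j)}
  one_mem' := fun _ _ _ => rfl
  mul_mem' := by
    intro α β hα hβ g h j
    simp only [Pi.mul_apply]
    rw [mul_mul_mul_comm, hα g h j, hβ g h j, mul_mul_mul_comm]
  inv_mem' := by
    intro α hα g h j
    simp only [Pi.inv_apply]
    rw [← mul_inv, hα g h j, mul_inv]

/-- The coboundary `(∂c)(g, h) = c(g) c(h) c(gh)⁻¹` of a function `c : G → Rˣ`. -/
def coboundaryMap (R : Type*) [CommRing R] (G : Type*) [Group G] :
    (G → Rˣ) →* (G → G → Rˣ) where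
  toFun c := fun g h => c g * c h * (c (g * h))⁻¹
  map_one' := by
    funext g h
    simp
  map_mul' c d := by
    funext g h
    simp only [Pi.mul_apply, mul_inv]
    rw [mul_mul_mul_comm (c g) (d g) (c h) (d h), mul_mul_mul_comm]

/-- The group `B²(G, Rˣ)` of 2-coboundaries, as a subgroup of `Z²(G, Rˣ)`. -/
def twoCoboundaries (R : Type*) [CommRing R] (G : Type*) [Group G] :
    Subgroup (twoCocycles R G) :=
  (coboundaryMap R G).range.subgroupOf (twoCocycles R G)

/-- The second cohomology group `H²(G, Rˣ) = Z²(G, Rˣ) / B²(G, Rˣ)`. -/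
abbrev SecondCohomology (R : Type*) [CommRing R] (G : Type*) [Group G] :=
  twoCocycles R G ⧸ twoCoboundaries R G

/-- The cohomology class `[α] ∈ H²(G, Rˣ)` of a 2-cocycle `α`. -/
def cohomologyClass {R : Type*} [CommRing R] {G : Type*} [Group G] (α : twoCocycles R G) :
    SecondCohomology R G :=
  QuotientGroup.mk α

/-- The twisted group ring `R^α G`: formal sums `∑ x_g ḡ` with finite support, that is, the free
`R`-module with basis `{ḡ | g ∈ G}`, with the multiplication determined by `ḡ h̄ = α(g, h) (gh)‾`
on the basis. -/
def TwistedGroupRing {R : Type*} [CommRing R] {G : Type*} [Group G] (_α : twoCocycles R G) :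
    Type _ :=
  G →₀ R

namespace TwistedGroupRing

variable {R : Type*} [CommRing R] {G : Type*} [Group G] {α : twoCocycles R G}

instance : AddCommGroup (TwistedGroupRing α) := inferInstanceAs (AddCommGroup (G →₀ R))

instance : Module R (TwistedGroupRing α) := inferInstanceAs (Module R (G →₀ R))

variable (α) in
/-- The basis `{ḡ | g ∈ G}` of `R^α G`. -/
def basis : Module.Basis G R (TwistedGroupRing α) :=
  Module.Basis.ofRepr (LinearEquiv.refl R (G →₀ R) : TwistedGroupRing α ≃ₗ[R] (G →₀ R))

variable (α) in
/-- The multiplication of `R^α G`: the `R`-bilinear map with `ḡ h̄ = α(g, h) (gh)‾`. -/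
def mulMap : TwistedGroupRing α →ₗ[R] TwistedGroupRing α →ₗ[R] TwistedGroupRing α :=
  (basis α).constr R fun g => (basis α).constr R fun h => (α.1 g h : R) • basis α (g * h)

instance : Mul (TwistedGroupRing α) := ⟨fun x y => mulMap α x y⟩

/-- The identity of `R^α G` is `α(1, 1)⁻¹ 1̄`. -/
instance : One (TwistedGroupRing α) := ⟨(((α.1 1 1)⁻¹ : Rˣ) : R) • basis α 1⟩

theorem mul_def (x y : TwistedGroupRing α) : x * y = mulMap α x y := rfl

theorem one_def : (1 : TwistedGroupRing α) = (((α.1 1 1)⁻¹ : Rˣ) : R) • basis α 1 := rfl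

theorem smul_basis_mul_smul_basis (g h : G) (a b : R) :
    (a • basis α g) * (b • basis α h) = (a * b * (α.1 g h : R)) • basis α (g * h) := by
  simp only [mul_def, mulMap, map_smul, LinearMap.smul_apply, Module.Basis.constr_basis,
    smul_smul]
  congr 1
  ring

theorem induction_on {p : TwistedGroupRing α → Prop} (x : TwistedGroupRing α) (h0 : p 0)
    (hs : ∀ (g : G) (a : R), p (a • basis α g)) (hadd : ∀ x y, p x → p y → p (x + y)) : p x := by
  rw [← (basis α).linearCombination_repr x]
  induction (basis α).repr x using Finsupp.induction_linear with
  | zero => rwa [map_zero]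
  | add f g hf hg =>
    rw [map_add]
    exact hadd _ _ hf hg
  | single g a =>
    rw [Finsupp.linearCombination_single]
    exact hs g a

theorem cocycle_one_left (α : twoCocycles R G) (g : G) : α.1 1 g = α.1 1 1 := by
  have h := α.2 1 1 g
  simp only [one_mul] at h
  exact (mul_right_cancel h).symm

theorem cocycle_one_right (α : twoCocycles R G) (g : G) : α.1 g 1 = α.1 1 1 := by
  have h := α.2 g 1 1
  simp only [mul_one] at h
  exact mul_right_cancel h

private theorem add_mul' (x y z : TwistedGroupRing α) : (x + y) * z = x * z + y * z := by
  simp only [mul_def, map_add, LinearMap.add_apply]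

private theorem mul_add' (x y z : TwistedGroupRing α) : x * (y + z) = x * y + x * z := by
  simp only [mul_def, map_add]

private theorem zero_mul' (x : TwistedGroupRing α) : 0 * x = 0 := by
  simp only [mul_def, map_zero, LinearMap.zero_apply]

private theorem mul_zero' (x : TwistedGroupRing α) : x * 0 = 0 := by
  simp only [mul_def, map_zero]

private theorem mul_assoc' (x y z : TwistedGroupRing α) : x * y * z = x * (y * z) := by
  induction x using induction_on with
  | h0 => simp only [zero_mul']
  | hadd x x' hx hx' => simp only [add_mul', hx, hx']
  | hs g a =>
    induction y using induction_on with
    | h0 => simp only [zero_mul', mul_zero']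
    | hadd y y' hy hy' => simp only [add_mul', mul_add', hy, hy']
    | hs h b =>
      induction z using induction_on with
      | h0 => simp only [mul_zero']
      | hadd z z' hz hz' => simp only [mul_add', hz, hz']
      | hs j c =>
        have e : (α.1 g h : R) * (α.1 (g * h) j : R) = (α.1 h j : R) * (α.1 g (h * j) : R) := by
          exact_mod_cast congrArg Units.val (α.2 g h j)
        simp only [smul_basis_mul_smul_basis, mul_assoc g h j]
        congr 1
        linear_combination a * b * c * e

private theorem one_mul' (x : TwistedGroupRing α) : 1 * x = x := by
  induction x using induction_on with
  | h0 => exact mul_zero' 1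
  | hadd x y hx hy => rw [mul_add', hx, hy]
  | hs g a =>
    rw [one_def, smul_basis_mul_smul_basis, one_mul, cocycle_one_left α g, mul_right_comm,
      Units.inv_mul, one_mul]

private theorem mul_one' (x : TwistedGroupRing α) : x * 1 = x := by
  induction x using induction_on with
  | h0 => exact zero_mul' 1
  | hadd x y hx hy => rw [add_mul', hx, hy]
  | hs g a =>
    rw [one_def, smul_basis_mul_smul_basis, mul_one, cocycle_one_right α g, mul_assoc,
      Units.inv_mul, mul_one]

instance : Ring (TwistedGroupRing α) :=
  { (inferInstance : AddCommGroup (TwistedGroupRing α)) with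
    mul := fun x y => x * y
    one := 1
    left_distrib := mul_add'
    right_distrib := add_mul'
    zero_mul := zero_mul'
    mul_zero := mul_zero'
    mul_assoc := mul_assoc'
    one_mul := one_mul'
    mul_one := mul_one' }

end TwistedGroupRing

/-- The relation `G ∼_R H`: there is a group isomorphism `φ : H²(G, Rˣ) → H²(H, Rˣ)` such that for
every class `[α] ∈ H²(G, Rˣ)` the rings `R^α G` and `R^β H` are isomorphic, where `β` is any cocycle
in the class `φ([α])`. -/
def TwistedEquiv (R : Type*) [CommRing R] (G H : Type*) [Group G] [Group H] : Prop :=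
  ∃ φ : SecondCohomology R G ≃* SecondCohomology R H,
    ∀ (α : twoCocycles R G) (β : twoCocycles R H),
      cohomologyClass β = φ (cohomologyClass α) →
        Nonempty (TwistedGroupRing α ≃+* TwistedGroupRing β)

end

/-! Over an algebraically closed field `F` of characteristic zero, the twisted group ring of a
finite group is semisimple, hence a product of matrix algebras over `F`. Its ring structure is
therefore encoded by the multiset of matrix sizes, called degrees here. A ring isomorphism, even one
that is not `F`-linear, preserves the degrees (`HasDegrees.exists_equiv`), and equal degrees give an
`F`-algebra isomorphism (`HasDegrees.nonempty_algEquiv`).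

Let `G` and `H` have coprime orders. Cocycles are symmetric on commuting elements of coprime orders,
so `H²(G × H)` is `H²(G) × H²(H)` (`SecondCohomology.prodEquiv`), and the degrees of an exterior
product are the pairwise products of degrees (`HasDegrees.prod`). Hence equivalences of the factors
combine to one of the products.

Conversely, `|G|` annihilates `H²(G)`, so an isomorphism between the cohomology groups of two such
products restricts to the factors. Degrees divide the group order (`HasDegrees.dvd_card`), so taking
the gcd of a product degree with `|G|` recovers the `G`-factor, and the degrees over `G` are
determined by those over `G × H` (`exists_equiv_of_prod_degrees`). This gives
`TwistedEquiv.prod_iff`. Induction extends it to finite products, and a finite nilpotent group is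
the product of its Sylow subgroups. -/

noncomputable section

/-! ### Algebra structure and maps out of twisted group rings -/

namespace TwistedGroupRing

variable {R : Type*} [CommRing R] {G H : Type*} [Group G] [Group H]

theorem basis_mul_basis (α : twoCocycles R G) (g h : G) :
    basis α g * basis α h = (α.1 g h : R) • basis α (g * h) := by
  simpa using smul_basis_mul_smul_basis (α := α) g h 1 1

instance (α : twoCocycles R G) : Algebra R (TwistedGroupRing α) :=
  Algebra.ofModule (fun r x y => by simp only [mul_def, map_smul, LinearMap.smul_apply])
    (fun r x y => by simp only [mul_def, map_smul])

theorem basis_one (α : twoCocycles R G) :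
    basis α 1 = (α.1 1 1 : R) • (1 : TwistedGroupRing α) := by
  rw [one_def, smul_smul, Units.mul_inv, one_smul]

/-- The universal property of the twisted group ring. -/
def lift (α : twoCocycles R G) {B : Type*} [Ring B] [Algebra R B] (u : G → B)
    (h1 : u 1 = (α.1 1 1 : R) • (1 : B)) (hm : ∀ g h, u g * u h = (α.1 g h : R) • u (g * h)) :
    TwistedGroupRing α →ₐ[R] B :=
  AlgHom.ofLinearMap ((basis α).constr R u)
    (by rw [one_def, map_smul, Module.Basis.constr_basis, h1, smul_smul, Units.inv_mul, one_smul])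
    (fun x y => by
      induction x using induction_on with
      | h0 => simp only [zero_mul, map_zero]
      | hadd x x' hx hx' => simp only [add_mul, map_add, hx, hx']
      | hs g a =>
        induction y using induction_on with
        | h0 => simp only [mul_zero, map_zero]
        | hadd y y' hy hy' => simp only [mul_add, map_add, hy, hy']
        | hs h b =>
          rw [smul_basis_mul_smul_basis]
          simp only [map_smul, Module.Basis.constr_basis, smul_mul_smul_comm, hm, smul_smul])

theorem lift_basis (α : twoCocycles R G) {B : Type*} [Ring B] [Algebra R B] (u : G → B)
    (h1 : u 1 = (α.1 1 1 : R) • (1 : B)) (hm : ∀ g h, u g * u h = (α.1 g h : R) • u (g * h))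
    (g : G) : lift α u h1 hm (basis α g) = u g :=
  (basis α).constr_basis R u g

/-- A group isomorphism along which two cocycles agree up to the coboundary of `c` induces an
isomorphism of twisted group rings. -/
theorem nonempty_algEquiv (α : twoCocycles R G) (β : twoCocycles R H) (e : G ≃* H) (c : G → Rˣ)
    (h : ∀ g g', α.1 g g' * c (g * g') = c g * c g' * β.1 (e g) (e g')) :
    Nonempty (TwistedGroupRing α ≃ₐ[R] TwistedGroupRing β) := by
  let L : TwistedGroupRing α ≃ₗ[R] TwistedGroupRing β :=
    (basis α).equiv ((basis β).unitsSMul (fun y => c (e.symm y))) e.toEquiv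
  have hL : ∀ g, L (basis α g) = (c g : R) • basis β (e g) := by
    intro g
    simp only [L, Module.Basis.equiv_apply, Module.Basis.unitsSMul_apply]
    simp [Units.smul_def]
  refine ⟨AlgEquiv.ofLinearEquiv L ?_ ?_⟩
  · rw [one_def, map_smul, hL, map_one, basis_one, smul_smul, smul_smul, ← Units.val_mul,
      ← Units.val_mul]
    have := h 1 1
    rw [mul_one, mul_right_comm, map_one] at this
    have h2 : α.1 1 1 = c 1 * β.1 1 1 := mul_right_cancel this
    rw [mul_assoc, ← h2, inv_mul_cancel, Units.val_one, one_smul]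
  · intro x y
    induction x using induction_on with
    | h0 => simp only [zero_mul, map_zero]
    | hadd x x' hx hx' => simp only [add_mul, map_add, hx, hx']
    | hs g a =>
      induction y using induction_on with
      | h0 => simp only [mul_zero, map_zero]
      | hadd y y' hy hy' => simp only [mul_add, map_add, hy, hy']
      | hs g' b =>
        have e1 : (α.1 g g' : R) * c (g * g') = c g * c g' * β.1 (e g) (e g') := by
          exact_mod_cast congrArg Units.val (h g g')
        simp only [smul_basis_mul_smul_basis, map_smul, hL, smul_smul, map_mul]
        congr 1
        linear_combination a * b * e1

end TwistedGroupRing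

/-! ### Second cohomology: functoriality, coprime products, torsion -/

section Cohomology

variable {R : Type*} [CommRing R] {G H K : Type*} [Group G] [Group H] [Group K]

theorem cohomologyClass_surjective :
    Function.Surjective (cohomologyClass : twoCocycles R G → SecondCohomology R G) :=
  QuotientGroup.mk_surjective

theorem cohomologyClass_mul (α β : twoCocycles R G) :
    cohomologyClass (α * β) = cohomologyClass α * cohomologyClass β := rfl

theorem SecondCohomology.commute (x y : SecondCohomology R G) : Commute x y := by
  obtain ⟨α, rfl⟩ := cohomologyClass_surjective x
  obtain ⟨β, rfl⟩ := cohomologyClass_surjective y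
  exact congrArg cohomologyClass (mul_comm α β)

/-- The condition is `β = α · ∂c` with denominators cleared. -/
theorem cohomologyClass_eq_iff {α β : twoCocycles R G} :
    cohomologyClass α = cohomologyClass β ↔
      ∃ c : G → Rˣ, ∀ g h, α.1 g h * (c g * c h) = c (g * h) * β.1 g h := by
  rw [cohomologyClass, cohomologyClass, QuotientGroup.eq, twoCoboundaries,
    Subgroup.mem_subgroupOf, MonoidHom.mem_range]
  refine exists_congr fun c => ?_
  rw [funext_iff]
  refine forall_congr' fun g => ?_
  rw [funext_iff]
  refine forall_congr' fun h => ?_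
  change c g * c h * (c (g * h))⁻¹ = (α.1 g h)⁻¹ * β.1 g h ↔ _
  rw [mul_inv_eq_iff_eq_mul, eq_comm, mul_assoc, inv_mul_eq_iff_eq_mul, eq_comm, mul_comm (β.1 g h)]

theorem TwistedGroupRing.nonempty_algEquiv_of_cohomologyClass_eq {α β : twoCocycles R G}
    (h : cohomologyClass α = cohomologyClass β) :
    Nonempty (TwistedGroupRing α ≃ₐ[R] TwistedGroupRing β) := by
  obtain ⟨c, hc⟩ := cohomologyClass_eq_iff.1 h.symm
  refine nonempty_algEquiv α β (MulEquiv.refl G) c fun g g' => ?_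
  simp only [MulEquiv.refl_apply]
  rw [mul_comm, ← hc, mul_comm]

/-- Pullback of 2-cocycles along a group homomorphism. -/
def twoCocycles.comap (R : Type*) [CommRing R] (f : G →* H) :
    twoCocycles R H →* twoCocycles R G where
  toFun α := ⟨fun g h => α.1 (f g) (f h), fun g h j => by simpa using α.2 (f g) (f h) (f j)⟩
  map_one' := rfl
  map_mul' _ _ := rfl

@[simp]
theorem twoCocycles.comap_apply (f : G →* H) (α : twoCocycles R H) (g h : G) :
    (twoCocycles.comap R f α).1 g h = α.1 (f g) (f h) := rfl

/-- The map induced on the second cohomology by a group homomorphism. -/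
def SecondCohomology.map (R : Type*) [CommRing R] (f : G →* H) :
    SecondCohomology R H →* SecondCohomology R G :=
  QuotientGroup.map _ _ (twoCocycles.comap R f) (by
    intro α hα
    have h1 : cohomologyClass (1 : twoCocycles R H) = cohomologyClass α :=
      QuotientGroup.eq.2 (by simpa using hα)
    obtain ⟨c, hc⟩ := cohomologyClass_eq_iff.1 h1
    have h2 : cohomologyClass 1 = cohomologyClass (twoCocycles.comap R f α) :=
      cohomologyClass_eq_iff.2 ⟨fun g => c (f g), fun g h => by simpa using hc (f g) (f h)⟩
    simpa using QuotientGroup.eq.1 h2)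

theorem SecondCohomology.map_cohomologyClass (f : G →* H) (α : twoCocycles R H) :
    SecondCohomology.map R f (cohomologyClass α) = cohomologyClass (twoCocycles.comap R f α) := rfl

theorem SecondCohomology.map_map (f : G →* H) (f' : H →* K) (x : SecondCohomology R K) :
    SecondCohomology.map R f (SecondCohomology.map R f' x) =
      SecondCohomology.map R (f'.comp f) x := by
  obtain ⟨α, rfl⟩ := cohomologyClass_surjective x
  rfl

theorem SecondCohomology.map_id (x : SecondCohomology R G) :
    SecondCohomology.map R (MonoidHom.id G) x = x := by
  obtain ⟨α, rfl⟩ := cohomologyClass_surjective x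
  rfl

/-- The pullback is the constant cocycle `α(1, 1)`, which is the coboundary of a constant function.
-/
theorem SecondCohomology.map_one_hom (x : SecondCohomology R H) :
    SecondCohomology.map R (1 : G →* H) x = 1 := by
  obtain ⟨α, rfl⟩ := cohomologyClass_surjective x
  refine cohomologyClass_eq_iff (β := 1).2 ⟨fun _ => (α.1 1 1)⁻¹, fun g h => ?_⟩
  simp

theorem SecondCohomology.map_comp_eq_one {f : G →* H} {f' : H →* K} (h : f'.comp f = 1)
    (x : SecondCohomology R K) :
    SecondCohomology.map R f (SecondCohomology.map R f' x) = 1 := by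
  rw [map_map, h, map_one_hom]

theorem SecondCohomology.map_comp_eq_self {f : G →* H} {f' : H →* G}
    (h : f'.comp f = MonoidHom.id G) (x : SecondCohomology R G) :
    SecondCohomology.map R f (SecondCohomology.map R f' x) = x := by
  rw [map_map, h, map_id]

/-- The isomorphism of second cohomology groups induced by a group isomorphism. -/
def SecondCohomology.congr (R : Type*) [CommRing R] (e : G ≃* H) :
    SecondCohomology R G ≃* SecondCohomology R H where
  toFun := SecondCohomology.map R e.symm.toMonoidHom
  invFun := SecondCohomology.map R e.toMonoidHom
  left_inv := SecondCohomology.map_comp_eq_self (by ext; simp)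
  right_inv := SecondCohomology.map_comp_eq_self (by ext; simp)
  map_mul' := map_mul _

theorem TwistedEquiv.of_mulEquiv (R : Type*) [CommRing R] (e : G ≃* H) : TwistedEquiv R G H := by
  refine ⟨SecondCohomology.congr R e, fun α β h => ?_⟩
  obtain ⟨f⟩ := TwistedGroupRing.nonempty_algEquiv_of_cohomologyClass_eq h
  obtain ⟨f'⟩ := TwistedGroupRing.nonempty_algEquiv α
    (twoCocycles.comap R e.symm.toMonoidHom α) e 1 (fun g g' => by simp)
  exact ⟨(f'.trans f.symm).toRingEquiv⟩

theorem TwistedEquiv.symm (h : TwistedEquiv R G H) : TwistedEquiv R H G := by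
  obtain ⟨φ, hφ⟩ := h
  refine ⟨φ.symm, fun α β h => ?_⟩
  obtain ⟨f⟩ := hφ β α (by rw [h, MulEquiv.apply_symm_apply])
  exact ⟨f.symm⟩

theorem TwistedEquiv.trans (h : TwistedEquiv R G H) (h' : TwistedEquiv R H K) :
    TwistedEquiv R G K := by
  obtain ⟨φ, hφ⟩ := h
  obtain ⟨ψ, hψ⟩ := h'
  refine ⟨φ.trans ψ, fun α β h => ?_⟩
  obtain ⟨γ, hγ⟩ := cohomologyClass_surjective (φ (cohomologyClass α))
  obtain ⟨f⟩ := hφ α γ hγ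
  obtain ⟨f'⟩ := hψ γ β (by rw [h, hγ, MulEquiv.trans_apply])
  exact ⟨f.trans f'⟩

theorem TwistedEquiv.congr {G' H' : Type*} [Group G'] [Group H'] (e : G ≃* G') (e' : H ≃* H') :
    TwistedEquiv R G H ↔ TwistedEquiv R G' H' :=
  ⟨fun h => ((TwistedEquiv.of_mulEquiv R e.symm).trans h).trans (TwistedEquiv.of_mulEquiv R e'),
    fun h => ((TwistedEquiv.of_mulEquiv R e).trans h).trans (TwistedEquiv.of_mulEquiv R e'.symm)⟩

/-- The exterior product of two 2-cocycles. -/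
def twoCocycles.prod (α : twoCocycles R G) (β : twoCocycles R H) : twoCocycles R (G × H) :=
  twoCocycles.comap R (MonoidHom.fst G H) α * twoCocycles.comap R (MonoidHom.snd G H) β

theorem twoCocycles.prod_apply (α : twoCocycles R G) (β : twoCocycles R H) (x y : G × H) :
    (twoCocycles.prod α β).1 x y = α.1 x.1 y.1 * β.1 x.2 y.2 := rfl

/-- The quotient `α(x, z) / α(z, x)` is multiplicative in `x` on the centralizer of `z`. -/
theorem twoCocycles.div_swap_mul (α : twoCocycles R G) {x y z : G} (hx : Commute x z)
    (hy : Commute y z) :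
    α.1 (x * y) z / α.1 z (x * y) = (α.1 x z / α.1 z x) * (α.1 y z / α.1 z y) := by
  have e1 := congrArg Additive.ofMul (α.2 x y z)
  have e2 := congrArg Additive.ofMul (α.2 x z y)
  have e3 := congrArg Additive.ofMul (α.2 z x y)
  rw [hy.eq] at e1
  rw [← hx.eq] at e3
  apply Additive.ofMul.injective
  simp only [ofMul_mul, ofMul_div] at *
  linear_combination (norm := abel) e1 - e2 + e3

theorem twoCocycles.div_swap_pow (α : twoCocycles R G) {x z : G} (hx : Commute x z) (n : ℕ) :
    α.1 (x ^ n) z / α.1 z (x ^ n) = (α.1 x z / α.1 z x) ^ n := by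
  induction n with
  | zero =>
    rw [pow_zero, pow_zero, TwistedGroupRing.cocycle_one_left α,
      TwistedGroupRing.cocycle_one_right α z, div_self']
  | succ n ih => rw [pow_succ, twoCocycles.div_swap_mul α (hx.pow_left n) hx, ih, pow_succ]

/-- A 2-cocycle is symmetric on commuting elements of coprime orders. -/
theorem twoCocycles.swap_of_coprime (α : twoCocycles R G) {x z : G} (h : Commute x z)
    (hc : (orderOf x).Coprime (orderOf z)) : α.1 x z = α.1 z x := by
  have key : ∀ {x z : G}, Commute x z → (α.1 x z / α.1 z x) ^ orderOf x = 1 := by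
    intro x z h
    rw [← twoCocycles.div_swap_pow α h, pow_orderOf_eq_one,
      TwistedGroupRing.cocycle_one_left α, TwistedGroupRing.cocycle_one_right α z, div_self']
  have h1 := key h
  have h2 := key h.symm
  rw [← inv_div, inv_pow, inv_eq_one] at h2
  have h3 := pow_gcd_eq_one.2 ⟨h1, h2⟩
  rwa [hc.gcd_eq_one, pow_one, div_eq_one] at h3

/-- In the twisted group ring, symmetry of `α` at `(b, a')` means that the basis elements of `b` and
`a'` commute, so the product over `a, b, a', b'` may be regrouped as that over `a, a', b, b'`. The
lemma compares the scalars of the two groupings. -/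
theorem twoCocycles.mul_interchange (α : twoCocycles R G) {a b a' b' : G} (h : Commute b a')
    (hs : α.1 b a' = α.1 a' b) :
    α.1 a b * α.1 a' b' * α.1 (a * b) (a' * b') =
      α.1 a a' * α.1 b b' * α.1 (a * a') (b * b') := by
  have e1 := congrArg Additive.ofMul (α.2 a b (a' * b'))
  have e2 := congrArg Additive.ofMul (α.2 b a' b')
  have e3 := congrArg Additive.ofMul (α.2 a' b b')
  have e4 := congrArg Additive.ofMul (α.2 a a' (b * b'))
  rw [← mul_assoc b a' b', h.eq, mul_assoc a' b b'] at e1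
  rw [hs, h.eq] at e2
  apply Additive.ofMul.injective
  simp only [ofMul_mul] at *
  linear_combination (norm := abel) e1 - e2 + e3 - e4

/-- On a product of two groups of coprime orders, every 2-cocycle is cohomologous to the exterior
product of its restrictions. -/
theorem SecondCohomology.eq_prod_of_coprime (hc : (Nat.card G).Coprime (Nat.card H))
    (x : SecondCohomology R (G × H)) :
    x = map R (MonoidHom.fst G H) (map R (MonoidHom.inl G H) x) *
      map R (MonoidHom.snd G H) (map R (MonoidHom.inr G H) x) := by
  obtain ⟨α, rfl⟩ := cohomologyClass_surjective x
  simp only [map_cohomologyClass, ← cohomologyClass_mul]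
  -- This is the scalar between the basis element of `(a, b)` and the product of those of `(a, 1)`
  -- and `(1, b)`. In the basis of such products the cocycle becomes the exterior product.
  refine cohomologyClass_eq_iff.2 ⟨fun p => α.1 (p.1, 1) (1, p.2), ?_⟩
  rintro ⟨a, b⟩ ⟨a', b'⟩
  have hcomm : Commute ((1, b) : G × H) (a', 1) := by simp [Commute, SemiconjBy]
  have hs : α.1 (1, b) (a', 1) = α.1 (a', 1) (1, b) := by
    refine twoCocycles.swap_of_coprime α hcomm ?_
    have h1 : orderOf ((1, b) : G × H) ∣ Nat.card H := by
      rw [Prod.orderOf_mk]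
      simpa using orderOf_dvd_natCard b
    have h2 : orderOf ((a', 1) : G × H) ∣ Nat.card G := by
      rw [Prod.orderOf_mk]
      simpa using orderOf_dvd_natCard a'
    exact Nat.Coprime.coprime_dvd_left h1 (Nat.Coprime.coprime_dvd_right h2 hc.symm)
  have := twoCocycles.mul_interchange α (a := (a, 1)) (b' := (1, b')) hcomm hs
  simp only [Prod.mk_mul_mk, one_mul, mul_one] at this
  rw [mul_comm, this, mul_comm]
  rfl

/-- For groups of coprime orders, `H²(G × H)` is the product of `H²(G)` and `H²(H)`. -/
def SecondCohomology.prodEquiv (R : Type*) [CommRing R]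
    (hc : (Nat.card G).Coprime (Nat.card H)) :
    SecondCohomology R G × SecondCohomology R H ≃* SecondCohomology R (G × H) where
  toFun x := map R (MonoidHom.fst G H) x.1 * map R (MonoidHom.snd G H) x.2
  invFun x := (map R (MonoidHom.inl G H) x, map R (MonoidHom.inr G H) x)
  left_inv x := by
    refine Prod.ext ?_ ?_
    · simp only [map_mul]
      rw [map_comp_eq_self (MonoidHom.fst_comp_inl), map_comp_eq_one (MonoidHom.snd_comp_inl)]
      exact mul_one x.1
    · simp only [map_mul]
      rw [map_comp_eq_self (MonoidHom.snd_comp_inr), map_comp_eq_one (MonoidHom.fst_comp_inr)]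
      exact one_mul x.2
  right_inv x := (eq_prod_of_coprime hc x).symm
  map_mul' x y := by
    simp only [Prod.fst_mul, Prod.snd_mul, map_mul]
    exact (SecondCohomology.commute _ _).mul_mul_mul_comm _ _

theorem SecondCohomology.prodEquiv_cohomologyClass (hc : (Nat.card G).Coprime (Nat.card H))
    (α : twoCocycles R G) (β : twoCocycles R H) :
    prodEquiv R hc (cohomologyClass α, cohomologyClass β) = cohomologyClass (twoCocycles.prod α β) := rfl

/-- Multiplying the cocycle identity over its third variable exhibits `α ^ |G|` as the coboundary of
`g ↦ ∏ j, α(g, j)`. -/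
theorem twoCocycles.pow_card_mul [Fintype G] (α : twoCocycles R G) (g h : G) :
    α.1 g h ^ Fintype.card G * ∏ j, α.1 (g * h) j = (∏ j, α.1 g j) * ∏ j, α.1 h j := by
  have h1 : ∏ j, α.1 g (h * j) = ∏ j, α.1 g j :=
    Fintype.prod_equiv (Equiv.mulLeft h) _ _ fun _ => rfl
  rw [← h1, mul_comm (∏ j, α.1 g (h * j)), ← Finset.prod_mul_distrib,
    ← Finset.prod_congr rfl fun j _ => α.2 g h j, Finset.prod_mul_distrib, Finset.prod_const,
    Finset.card_univ]

/-- The order of a finite group annihilates its second cohomology. -/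
theorem SecondCohomology.pow_card_eq_one [Finite G] (x : SecondCohomology R G) :
    x ^ Nat.card G = 1 := by
  have := Fintype.ofFinite G
  obtain ⟨α, rfl⟩ := cohomologyClass_surjective x
  symm
  refine cohomologyClass_eq_iff (α := 1) (β := α ^ Nat.card G).2
    ⟨fun g => ∏ j, α.1 g j, fun g h => ?_⟩
  rw [Nat.card_eq_fintype_card]
  change 1 * _ = _ * α.1 g h ^ Fintype.card G
  rw [one_mul, mul_comm _ (_ ^ _), twoCocycles.pow_card_mul α]

/-- Over an algebraically closed field, every 2-cocycle of a finite group is cohomologous to one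
with values in the roots of unity. -/
theorem twoCocycles.exists_pow_card_eq_one {F : Type*} [Field F] [IsAlgClosed F] [Finite G]
    (α : twoCocycles F G) : ∃ β : twoCocycles F G, cohomologyClass α = cohomologyClass β ∧
      ∀ g h, β.1 g h ^ Nat.card G = 1 := by
  have := Fintype.ofFinite G
  have hroot : ∀ g : G, ∃ b : Fˣ, b ^ Nat.card G = ∏ j, α.1 g j := by
    intro g
    obtain ⟨z, hz⟩ := IsAlgClosed.exists_pow_nat_eq ((∏ j, α.1 g j : Fˣ) : F)
      (Nat.card_pos (α := G))
    have hz0 : z ≠ 0 := by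
      rintro rfl
      rw [zero_pow Nat.card_pos.ne'] at hz
      exact (Units.ne_zero _) hz.symm
    exact ⟨Units.mk0 z hz0, Units.ext (by simpa using hz)⟩
  choose b hb using hroot
  -- Since `α ^ |G|` is the coboundary of `b ^ |G|`, dividing `α` by the coboundary of `b` leaves a
  -- cocycle whose `|G|`-th power is trivial.
  let β : twoCocycles F G := α * ⟨coboundaryMap F G b⁻¹, fun g h j => by
    change (b g)⁻¹ * (b h)⁻¹ * (b (g * h))⁻¹⁻¹ * ((b (g * h))⁻¹ * (b j)⁻¹ * (b (g * h * j))⁻¹⁻¹) =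
      (b h)⁻¹ * (b j)⁻¹ * (b (h * j))⁻¹⁻¹ * ((b g)⁻¹ * (b (h * j))⁻¹ * (b (g * (h * j)))⁻¹⁻¹)
    rw [mul_assoc g h j]
    apply Additive.ofMul.injective
    simp only [ofMul_mul, ofMul_inv]
    abel⟩
  have hβ : ∀ g h, β.1 g h = α.1 g h * ((b g)⁻¹ * (b h)⁻¹ * (b (g * h))⁻¹⁻¹) := fun _ _ => rfl
  refine ⟨β, cohomologyClass_eq_iff.2 ⟨b⁻¹, fun g h => ?_⟩, fun g h => ?_⟩
  · rw [hβ]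
    simp only [Pi.inv_apply]
    rw [inv_inv, mul_left_comm (b (g * h))⁻¹, mul_comm _ (b (g * h)), inv_mul_cancel_left]
  · have := twoCocycles.pow_card_mul α g h
    rw [← Nat.card_eq_fintype_card, ← hb, ← hb, ← hb] at this
    rw [hβ, inv_inv, mul_pow, mul_pow, mul_pow, inv_pow, inv_pow, mul_comm (_ * _) (b _ ^ _),
      ← mul_assoc, this, ← mul_inv, mul_inv_cancel]

end Cohomology

/-! ### Semisimplicity and degrees -/

namespace TwistedGroupRing

section Semisimple

variable {F : Type*} [Field F] {G : Type*} [Group G]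

instance [Finite G] (α : twoCocycles F G) : Module.Finite F (TwistedGroupRing α) :=
  Module.Finite.of_basis (basis α)

theorem finrank_eq_card (α : twoCocycles F G) :
    Module.finrank F (TwistedGroupRing α) = Nat.card G :=
  Module.finrank_eq_nat_card_basis (basis α)

/-- Moves the coefficient at `g` to the identity, where the trace can detect it. -/
theorem repr_basis_inv_mul (α : twoCocycles F G) (g : G) (x : TwistedGroupRing α) :
    (basis α).repr (basis α g⁻¹ * x) 1 = α.1 g⁻¹ g * (basis α).repr x g := by
  classical
  induction x using induction_on with
  | h0 => simp
  | hadd x y hx hy => simp only [mul_add, map_add, Finsupp.add_apply, hx, hy]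
  | hs h a =>
    have := smul_basis_mul_smul_basis (α := α) g⁻¹ h 1 a
    rw [one_smul] at this
    rw [this, map_smul, map_smul, Module.Basis.repr_self, Module.Basis.repr_self]
    by_cases hg : h = g
    · subst hg
      simp [mul_comm]
    · have h1 : ¬ g⁻¹ * h = 1 := fun h1 => hg (inv_mul_eq_one.1 h1).symm
      simp [hg, h1]

/-- Left multiplication by a basis element permutes the basis up to scalars, without fixed points
unless the element is that of `1`, which acts as `α(1, 1)`. -/
theorem trace_lmul [Finite G] (α : twoCocycles F G) (x : TwistedGroupRing α) :
    LinearMap.trace F _ (Algebra.lmul F (TwistedGroupRing α) x) =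
      Nat.card G * ((α.1 1 1 : F) * (basis α).repr x 1) := by
  classical
  have := Fintype.ofFinite G
  induction x using induction_on with
  | h0 => simp
  | hadd x y hx hy => simp only [map_add, Finsupp.add_apply, hx, hy, mul_add]
  | hs g a =>
    rw [map_smul, map_smul, LinearMap.trace_eq_matrix_trace F (basis α), Matrix.trace]
    simp only [Matrix.diag_apply, LinearMap.toMatrix_apply, Algebra.coe_lmul_eq_mul,
      LinearMap.mul_apply', basis_mul_basis, map_smul, Module.Basis.repr_self,
      Finsupp.smul_apply, Finsupp.single_apply, mul_eq_right]
    by_cases hg : g = 1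
    · subst hg
      simp only [if_true, cocycle_one_left α, smul_eq_mul, mul_one, Finset.sum_const,
        Finset.card_univ, nsmul_eq_mul, Nat.card_eq_fintype_card]
      ring
    · simp [hg]

/-- Maschke's theorem for twisted group rings. -/
theorem isSemisimpleRing [CharZero F] [Finite G] (α : twoCocycles F G) :
    IsSemisimpleRing (TwistedGroupRing α) := by
  have : IsArtinianRing (TwistedGroupRing α) := IsArtinianRing.of_finite F _
  rw [IsArtinianRing.isSemisimpleRing_iff_jacobson, eq_bot_iff]
  intro x hx
  rw [Submodule.mem_bot, ← (basis α).repr.map_eq_zero_iff]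
  ext g
  have hmem : basis α g⁻¹ * x ∈ Ring.jacobson (TwistedGroupRing α) := Ideal.mul_mem_left _ _ hx
  -- A nilpotent element has trace zero, which kills the coefficient of `x` at `g`.
  have hnil : IsNilpotent (basis α g⁻¹ * x) := by
    obtain ⟨n, hn⟩ := IsSemiprimaryRing.isNilpotent (R := TwistedGroupRing α)
    refine ⟨n, ?_⟩
    have := Ideal.pow_mem_pow hmem n
    rwa [hn] at this
  have htr := (LinearMap.isNilpotent_trace_of_isNilpotent
    (hnil.map (Algebra.lmul F (TwistedGroupRing α)))).eq_zero
  rw [trace_lmul, repr_basis_inv_mul] at htr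
  simpa [Nat.card_pos.ne'] using htr

/-- `HasDegrees α d` says that the twisted group ring of `α` is isomorphic to the product of the
matrix algebras of the positive sizes `d i`. -/
def HasDegrees (α : twoCocycles F G) {ι : Type*} (d : ι → ℕ) : Prop :=
  (∀ i, d i ≠ 0) ∧
    Nonempty (TwistedGroupRing α ≃ₐ[F] Π i, Matrix (Fin (d i)) (Fin (d i)) F)

theorem exists_hasDegrees [IsAlgClosed F] [CharZero F] [Finite G] (α : twoCocycles F G) :
    ∃ (n : ℕ) (d : Fin n → ℕ), HasDegrees α d := by
  have := isSemisimpleRing α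
  obtain ⟨n, d, hd, e⟩ := IsSemisimpleRing.exists_algEquiv_pi_matrix_of_isAlgClosed F
    (TwistedGroupRing α)
  exact ⟨n, d, fun i => (hd i).out, e⟩

theorem HasDegrees.of_algEquiv {H : Type*} [Group H] {α : twoCocycles F G} {β : twoCocycles F H}
    {ι : Type*} {d : ι → ℕ} (h : HasDegrees α d)
    (e : TwistedGroupRing β ≃ₐ[F] TwistedGroupRing α) : HasDegrees β d :=
  ⟨h.1, h.2.map e.trans⟩

theorem HasDegrees.sum_sq {α : twoCocycles F G} {ι : Type*} [Fintype ι] {d : ι → ℕ}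
    (h : HasDegrees α d) : ∑ i, d i ^ 2 = Nat.card G := by
  obtain ⟨-, ⟨e⟩⟩ := h
  have := e.toLinearEquiv.finrank_eq
  rw [finrank_eq_card, Module.finrank_pi_fintype] at this
  rw [this]
  exact Finset.sum_congr rfl fun i _ => by simp [Module.finrank_matrix, sq]

end Semisimple

end TwistedGroupRing

/-! ### Ring isomorphisms between products of matrix rings -/

section MatrixProducts

variable {F : Type*} [Field F]

/-- Cayley–Hamilton: the characteristic polynomial of a nilpotent matrix is a power of `X`. -/
theorem Matrix.pow_card_eq_zero_of_isNilpotent {n : Type*} [Fintype n] [DecidableEq n]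
    {M : Matrix n n F} (h : IsNilpotent M) : M ^ Fintype.card n = 0 := by
  have h1 := (Matrix.isNilpotent_charpoly_sub_pow_of_isNilpotent h).eq_zero
  have h2 := Matrix.aeval_self_charpoly M
  rw [sub_eq_zero.1 h1] at h2
  simpa using h2

/-- The shift matrix. Its nilpotency index detects the matrix size by ring operations alone, so no
linearity is needed later. -/
theorem Matrix.exists_pow_eq_zero_iff (R : Type*) [Semiring R] [Nontrivial R] (n : ℕ) :
    ∃ N : Matrix (Fin n) (Fin n) R, ∀ k, N ^ k = 0 ↔ n ≤ k := by
  let N : Matrix (Fin n) (Fin n) R := Matrix.of fun a b => if (a : ℕ) + 1 = b then 1 else 0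
  have hN : ∀ k a b, (N ^ k) a b = if (a : ℕ) + k = b then 1 else 0 := by
    intro k
    induction k with
    | zero => intro a b; simp [Matrix.one_apply, Fin.ext_iff]
    | succ k ih =>
      intro a b
      rw [pow_succ, Matrix.mul_apply]
      simp only [ih, N, Matrix.of_apply, ite_mul, one_mul, zero_mul]
      by_cases h : (a : ℕ) + k < n
      · rw [Finset.sum_eq_single ⟨a + k, h⟩]
        · simp [add_assoc]
        · intro c _ hc
          rw [if_neg fun h' => hc (Fin.ext h'.symm)]
        · simp
      · rw [if_neg (by omega)]
        exact Finset.sum_eq_zero fun c _ => if_neg (by omega)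
  refine ⟨N, fun k => ⟨fun h => ?_, fun h => ?_⟩⟩
  · by_contra! hk
    have := hN k ⟨0, by omega⟩ ⟨k, hk⟩
    rw [h] at this
    simp at this
  · ext a b
    rw [hN, if_neg (by omega), Matrix.zero_apply]

theorem Matrix.eq_zero_or_one_of_isIdempotentElem_of_commute {n : Type*} [Fintype n]
    [DecidableEq n] {M : Matrix n n F} (h : IsIdempotentElem M) (hc : ∀ A, Commute A M) :
    M = 0 ∨ M = 1 := by
  obtain ⟨c, rfl⟩ := Matrix.mem_range_scalar_iff_commute_single'.2 fun i j => hc _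
  cases isEmpty_or_nonempty n
  · exact Or.inl (Subsingleton.elim _ _)
  · have h1 : IsIdempotentElem c := by
      rw [IsIdempotentElem, ← map_mul] at h
      exact Matrix.scalar_inj.1 h
    obtain rfl | rfl := IsIdempotentElem.iff_eq_zero_or_one.1 h1
    · exact Or.inl (map_zero _)
    · exact Or.inr (map_one _)

variable {ι κ : Type*} [DecidableEq ι] [DecidableEq κ] {d : ι → ℕ} {e : κ → ℕ}

/-- The image of a nilpotent of index `d i` in block `i` lives in block `j`, where its `e j`-th
power already vanishes. -/
theorem Matrix.size_le_of_map_piSingle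
    (f : (Π i, Matrix (Fin (d i)) (Fin (d i)) F) ≃+* (Π j, Matrix (Fin (e j)) (Fin (e j)) F))
    {i : ι} {j : κ} (h : f (Pi.single i 1) = Pi.single j 1) : d i ≤ e j := by
  obtain ⟨N, hN⟩ := Matrix.exists_pow_eq_zero_iff F (d i)
  rw [← hN]
  -- The block idempotent in front makes the formula valid at `k = 0`, where the bare power is `1`
  -- in every block.
  have hpow : ∀ k, (Pi.single i 1 : Π i, Matrix (Fin (d i)) (Fin (d i)) F) * Pi.single i N ^ k =
      Pi.single i (N ^ k) := by
    intro k
    induction k with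
    | zero =>
      rw [pow_zero, pow_zero, mul_one]
    | succ k ih => rw [pow_succ, ← mul_assoc, ih, ← Pi.single_mul, pow_succ]
  have hnil : IsNilpotent (f (Pi.single i N) j) := by
    refine ⟨d i, ?_⟩
    have h1 := congrArg (fun x => f x j) (hpow (d i))
    rw [(hN _).2 le_rfl] at h1
    simpa [h] using h1
  have h1 := Matrix.pow_card_eq_zero_of_isNilpotent hnil
  rw [Fintype.card_fin] at h1
  have h2 : f (Pi.single i (N ^ e j)) = 0 := by
    rw [← hpow, map_mul, map_pow, h]
    ext1 j'
    by_cases hj : j' = j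
    · subst hj
      simp [h1]
    · simp [hj]
  rw [map_eq_zero_iff f f.injective] at h2
  simpa using congrFun h2 i

/-- The block units are orthogonal central idempotents with sum `1`. Each component of their images
is `0` or `1`, so exactly one of them is `1` in block `j`; its index is `τ j`. Injectivity of `f`
makes `τ` surjective. -/
theorem Matrix.exists_equiv_of_pi_ringEquiv_aux [Fintype ι] [Fintype κ] (hd : ∀ i, d i ≠ 0)
    (he : ∀ j, e j ≠ 0)
    (f : (Π i, Matrix (Fin (d i)) (Fin (d i)) F) ≃+* (Π j, Matrix (Fin (e j)) (Fin (e j)) F)) :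
    ∃ τ : κ → ι, Function.Surjective τ ∧
      ∀ j i, f (Pi.single i 1) j = if i = τ j then 1 else 0 := by
  have hd' : ∀ i, NeZero (d i) := fun i => ⟨hd i⟩
  have he' : ∀ i, NeZero (e i) := fun i => ⟨he i⟩
  have h01 : ∀ i j, f (Pi.single i 1) j = 0 ∨ f (Pi.single i 1) j = 1 := by
    intro i j
    apply Matrix.eq_zero_or_one_of_isIdempotentElem_of_commute
    · rw [IsIdempotentElem, ← Pi.mul_apply, ← map_mul, ← Pi.single_mul, mul_one]
    · intro A
      have hcomm : ∀ x, Commute x (Pi.single i 1 : Π i, Matrix (Fin (d i)) (Fin (d i)) F) := by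
        intro x
        ext1 i'
        by_cases hi : i' = i
        · subst hi
          simp
        · simp [hi]
      have := congrFun ((hcomm (f.symm (Pi.single j A))).map f).eq j
      simpa [Commute, SemiconjBy] using this
  have hex : ∀ j, ∃ i, f (Pi.single i 1) j = 1 := by
    intro j
    by_contra! hj
    have h1 : f 1 j = 0 := by
      have : (1 : Π i, Matrix (Fin (d i)) (Fin (d i)) F) = ∑ i, Pi.single i 1 :=
        (Finset.univ_sum_single _).symm
      rw [this, map_sum, Finset.sum_apply]
      exact Finset.sum_eq_zero fun i _ => (h01 i j).resolve_right (hj i)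
    rw [map_one] at h1
    exact one_ne_zero h1
  choose τ hτ using hex
  have hval : ∀ j i, f (Pi.single i 1) j = if i = τ j then 1 else 0 := by
    intro j i
    split_ifs with h
    · rw [h, hτ]
    · have h1 : (Pi.single i 1 * Pi.single (τ j) 1 : Π i, Matrix (Fin (d i)) (Fin (d i)) F) = 0 := by
        ext1 i'
        by_cases hi : i' = i
        · subst hi
          simp [h]
        · simp [hi]
      have h2 := congrFun (congrArg f h1) j
      rwa [map_mul, map_zero, Pi.mul_apply, hτ, mul_one] at h2
  refine ⟨τ, fun i => ?_, hval⟩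
  by_contra! hi
  have h1 : f (Pi.single i 1) = 0 := by
    ext1 j
    rw [hval, if_neg (hi j).symm, Pi.zero_apply]
  rw [map_eq_zero_iff f f.injective] at h1
  have := congrFun h1 i
  rw [Pi.single_eq_same] at this
  exact one_ne_zero this

/-- Isomorphic finite products of matrix rings have the same matrix sizes up to permutation. -/
theorem Matrix.exists_equiv_of_pi_ringEquiv [Finite ι] [Finite κ] (hd : ∀ i, d i ≠ 0)
    (he : ∀ j, e j ≠ 0)
    (f : (Π i, Matrix (Fin (d i)) (Fin (d i)) F) ≃+* (Π j, Matrix (Fin (e j)) (Fin (e j)) F)) :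
    ∃ σ : ι ≃ κ, ∀ i, e (σ i) = d i := by
  have := Fintype.ofFinite ι
  have := Fintype.ofFinite κ
  obtain ⟨τ, hτ, hval⟩ := Matrix.exists_equiv_of_pi_ringEquiv_aux hd he f
  obtain ⟨τ', hτ', -⟩ := Matrix.exists_equiv_of_pi_ringEquiv_aux he hd f.symm
  have hb : Function.Bijective τ := (Fintype.bijective_iff_surjective_and_card τ).2
    ⟨hτ, le_antisymm (Fintype.card_le_of_surjective τ' hτ') (Fintype.card_le_of_surjective τ hτ)⟩
  have hf : ∀ j, f (Pi.single (τ j) 1) = Pi.single j 1 := by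
    intro j
    ext1 j'
    rw [hval]
    by_cases hj : j' = j
    · subst hj
      simp
    · rw [if_neg fun h => hj (hb.1 h).symm, Pi.single_eq_of_ne hj]
  have hkey : ∀ j, e j = d (τ j) := fun j => le_antisymm
    (Matrix.size_le_of_map_piSingle f.symm (by rw [← hf, RingEquiv.symm_apply_apply]))
    (Matrix.size_le_of_map_piSingle f (hf j))
  refine ⟨(Equiv.ofBijective τ hb).symm, fun i => ?_⟩
  rw [hkey]
  exact congrArg d ((Equiv.ofBijective τ hb).apply_symm_apply i)

end MatrixProducts

/-! ### Degrees as a complete invariant, and degrees of exterior products -/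

namespace TwistedGroupRing

variable {F : Type*} [Field F] {G H : Type*} [Group G] [Group H] {α : twoCocycles F G}
  {β : twoCocycles F H}

theorem HasDegrees.exists_equiv {ι κ : Type*} [Finite ι] [Finite κ] {d : ι → ℕ} {e : κ → ℕ}
    (hα : HasDegrees α d) (hβ : HasDegrees β e) (f : TwistedGroupRing α ≃+* TwistedGroupRing β) :
    ∃ σ : ι ≃ κ, ∀ i, e (σ i) = d i := by
  classical
  obtain ⟨hd, ⟨a⟩⟩ := hα
  obtain ⟨he, ⟨b⟩⟩ := hβ
  exact Matrix.exists_equiv_of_pi_ringEquiv hd he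
    ((a.symm.toRingEquiv.trans f).trans b.toRingEquiv)

theorem HasDegrees.nonempty_algEquiv {ι κ : Type*} {d : ι → ℕ} {e : κ → ℕ} (hα : HasDegrees α d)
    (hβ : HasDegrees β e) (σ : ι ≃ κ) (h : ∀ i, e (σ i) = d i) :
    Nonempty (TwistedGroupRing α ≃ₐ[F] TwistedGroupRing β) := by
  obtain ⟨-, ⟨a⟩⟩ := hα
  obtain ⟨-, ⟨b⟩⟩ := hβ
  obtain rfl : d = fun i => e (σ i) := funext fun i => (h i).symm
  exact ⟨a.trans ((AlgEquiv.piCongrLeft F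
    (fun j => Matrix (Fin (e j)) (Fin (e j)) F) σ).trans b.symm)⟩

/-- Twisted group rings over an algebraically closed field of characteristic zero which are
isomorphic as rings are isomorphic as algebras. -/
theorem nonempty_algEquiv_of_ringEquiv [IsAlgClosed F] [CharZero F] [Finite G] [Finite H]
    (f : TwistedGroupRing α ≃+* TwistedGroupRing β) :
    Nonempty (TwistedGroupRing α ≃ₐ[F] TwistedGroupRing β) := by
  obtain ⟨m, d, hd⟩ := exists_hasDegrees α
  obtain ⟨n, e, he⟩ := exists_hasDegrees β
  obtain ⟨σ, hσ⟩ := hd.exists_equiv he f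
  exact hd.nonempty_algEquiv he σ hσ

-- Kronecker products of the blocks define an algebra map from the twisted group ring of the
-- exterior product. It is surjective because it reaches every matrix unit, and bijective because
-- both dimensions are `|G| |H|` by the sum-of-squares formula.
open scoped Kronecker in
theorem HasDegrees.prod {ι κ : Type*} [Finite ι] [Finite κ] [Finite G] [Finite H] {d : ι → ℕ}
    {e : κ → ℕ} (hα : HasDegrees α d) (hβ : HasDegrees β e) :
    HasDegrees (twoCocycles.prod α β) (fun p : ι × κ => d p.1 * e p.2) := by
  classical
  have := Fintype.ofFinite ι
  have := Fintype.ofFinite κ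
  refine ⟨fun p => mul_ne_zero (hα.1 p.1) (hβ.1 p.2), ?_⟩
  have hsumα := hα.sum_sq
  have hsumβ := hβ.sum_sq
  obtain ⟨-, ⟨a⟩⟩ := hα
  obtain ⟨-, ⟨b⟩⟩ := hβ
  let T : Type _ := Π p : ι × κ,
    Matrix (Fin (d p.1) × Fin (e p.2)) (Fin (d p.1) × Fin (e p.2)) F
  let K : TwistedGroupRing α → TwistedGroupRing β → T := fun x y p => a x p.1 ⊗ₖ b y p.2
  have hKadd : ∀ x x' y, K (x + x') y = K x y + K x' y := fun x x' y => by
    ext1 p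
    simp only [K, map_add, Pi.add_apply, Matrix.add_kronecker]
    rfl
  have hKadd' : ∀ x y y', K x (y + y') = K x y + K x y' := fun x y y' => by
    ext1 p
    simp only [K, map_add, Pi.add_apply, Matrix.kronecker_add]
    rfl
  have hKsmul : ∀ (r : F) x y, K (r • x) y = r • K x y := fun r x y => by
    ext1 p
    simp only [K, map_smul, Pi.smul_apply, Matrix.smul_kronecker]
    rfl
  have hKsmul' : ∀ (r : F) x y, K x (r • y) = r • K x y := fun r x y => by
    ext1 p
    simp only [K, map_smul, Pi.smul_apply, Matrix.kronecker_smul]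
    rfl
  have hKmul : ∀ x x' y y', K x y * K x' y' = K (x * x') (y * y') := fun x x' y y' => by
    ext1 p
    simp only [K, map_mul, Pi.mul_apply, Matrix.mul_kronecker_mul]
    rfl
  have hKone : K 1 1 = 1 := by
    ext1 p
    simp only [K, map_one, Pi.one_apply, Matrix.one_kronecker_one]
    rfl
  have hbone : K (basis α 1) (basis β 1) = ((twoCocycles.prod α β).1 1 1 : F) • (1 : T) := by
    rw [basis_one, basis_one, hKsmul, hKsmul', hKone, smul_smul, twoCocycles.prod_apply,
      Units.val_mul, Prod.fst_one, Prod.snd_one]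
  have hbmul : ∀ p q : G × H, K (basis α p.1) (basis β p.2) * K (basis α q.1) (basis β q.2) =
      ((twoCocycles.prod α β).1 p q : F) • K (basis α (p * q).1) (basis β (p * q).2) := by
    intro p q
    rw [hKmul, basis_mul_basis, basis_mul_basis, hKsmul, hKsmul', smul_smul,
      twoCocycles.prod_apply, Units.val_mul]
    rfl
  let L : TwistedGroupRing (twoCocycles.prod α β) →ₐ[F] T :=
    lift (twoCocycles.prod α β) (fun p => K (basis α p.1) (basis β p.2)) hbone hbmul
  have hL : ∀ x y, K x y ∈ LinearMap.range L.toLinearMap := by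
    intro x y
    induction x using induction_on with
    | h0 =>
      have : K 0 y = 0 := by
        ext1 p
        simp only [K, map_zero, Pi.zero_apply, Matrix.zero_kronecker]
        rfl
      rw [this]
      exact zero_mem _
    | hadd x x' hx hx' => rw [hKadd]; exact add_mem hx hx'
    | hs g r =>
      rw [hKsmul]
      refine Submodule.smul_mem _ _ ?_
      induction y using induction_on with
      | h0 =>
        have : K (basis α g) 0 = 0 := by
          ext1 p
          simp only [K, map_zero, Pi.zero_apply, Matrix.kronecker_zero]
          rfl
        rw [this]
        exact zero_mem _
      | hadd y y' hy hy' => rw [hKadd']; exact add_mem hy hy'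
      | hs h s =>
        rw [hKsmul']
        exact Submodule.smul_mem _ _ ⟨basis _ (g, h), lift_basis _ _ hbone hbmul (g, h)⟩
  have hsurj : Function.Surjective L.toLinearMap := by
    rw [← LinearMap.range_eq_top, eq_top_iff]
    intro W _
    rw [← Finset.univ_sum_single W]
    refine sum_mem fun p _ => ?_
    have hW : Pi.single p (W p) = ∑ s, ∑ t, W p s t •
        (Pi.single p (Matrix.single s t 1) : T) := by
      rw [← LinearMap.single_apply (R := F), Matrix.matrix_eq_sum_single (W p), map_sum]
      refine Finset.sum_congr rfl fun s _ => ?_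
      rw [map_sum]
      refine Finset.sum_congr rfl fun t _ => ?_
      rw [← LinearMap.single_apply (R := F), ← map_smul, Matrix.smul_single, smul_eq_mul, mul_one]
      rw [← Matrix.matrix_eq_sum_single (W p)]
    rw [hW]
    refine sum_mem fun s _ => sum_mem fun t _ => Submodule.smul_mem _ _ ?_
    -- A matrix unit in block `p` is the Kronecker product of matrix units of the two factor blocks.
    convert hL (a.symm (Pi.single p.1 (Matrix.single s.1 t.1 1)))
      (b.symm (Pi.single p.2 (Matrix.single s.2 t.2 1)))
    ext1 q
    simp only [K, AlgEquiv.apply_symm_apply]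
    by_cases h1 : q.1 = p.1
    · by_cases h2 : q.2 = p.2
      · obtain rfl : q = p := Prod.ext h1 h2
        rw [Pi.single_eq_same, Pi.single_eq_same, Pi.single_eq_same,
          Matrix.single_kronecker_single, mul_one]
      · rw [Pi.single_eq_of_ne h2, Matrix.kronecker_zero,
          Pi.single_eq_of_ne fun h => h2 (congrArg Prod.snd h)]
    · rw [Pi.single_eq_of_ne h1, Matrix.zero_kronecker,
        Pi.single_eq_of_ne fun h => h1 (congrArg Prod.fst h)]
  have hrank : Module.finrank F (TwistedGroupRing (twoCocycles.prod α β)) = Module.finrank F T := by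
    rw [finrank_eq_card, Nat.card_prod, ← hsumα, ← hsumβ, Module.finrank_pi_fintype,
      Finset.sum_mul_sum, Fintype.sum_prod_type]
    refine Finset.sum_congr rfl fun i _ => Finset.sum_congr rfl fun j _ => ?_
    simp only [Module.finrank_matrix, Fintype.card_prod, Fintype.card_fin, Module.finrank_self]
    ring
  have hinj := (LinearMap.injective_iff_surjective_of_finrank_eq_finrank hrank).2 hsurj
  exact ⟨(AlgEquiv.ofBijective L ⟨hinj, hsurj⟩).trans
    (AlgEquiv.piCongrRight fun p => Matrix.reindexAlgEquiv F F finProdFinEquiv)⟩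

end TwistedGroupRing

/-! ### Degrees divide the group order -/

/-- The `ℤ`-span of a finite monoid is a subring that is finitely generated over `ℤ`. -/
theorem IsIntegral.of_mem_span_of_finite {A : Type*} [Ring A] (K : Submonoid A)
    (hK : (K : Set A).Finite) {x : A} (hx : x ∈ Submodule.span ℤ (K : Set A)) :
    IsIntegral ℤ x := by
  have h : Subalgebra.toSubmodule (Algebra.adjoin ℤ (K : Set A)) =
      Submodule.span ℤ (K : Set A) := by
    rw [Algebra.adjoin_eq_span, Submonoid.closure_eq]
  refine IsIntegral.of_mem_of_fg (Algebra.adjoin ℤ (K : Set A)) ?_ x ?_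
  · rw [h]
    exact Submodule.fg_span hK
  · rwa [← Subalgebra.mem_toSubmodule, h]

namespace TwistedGroupRing

variable {F : Type*} [Field F] {G : Type*} [Group G] {m : Type*} [Fintype m] [DecidableEq m]

/-- Averaging a matrix over an irreducible projective representation gives a scalar matrix. -/
theorem exists_sum_conj_eq_scalar [Fintype G] (α : twoCocycles F G)
    (ρ : TwistedGroupRing α →ₐ[F] Matrix m m F) (hρ : Function.Surjective ρ)
    (v : G → Matrix m m F) (huv : ∀ g, ρ (basis α g) * v g = 1) (x : Matrix m m F) :
    ∃ c : F, ∑ g, ρ (basis α g) * x * v g = Matrix.scalar m c ∧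
      Fintype.card m * c = Fintype.card G * x.trace := by
  have hvu : ∀ g, v g * ρ (basis α g) = 1 := fun g => mul_eq_one_comm.1 (huv g)
  -- The same scalar `α(h, g)` arises on the left from the product of basis elements, so the
  -- substitution `g ↦ h * g` shows that the average commutes with the image of `h`.
  have hv : ∀ h g, v (h * g) * ρ (basis α h) = (α.1 h g : F) • v g := by
    intro h g
    have h1 : ρ (basis α h) * ρ (basis α g) = (α.1 h g : F) • ρ (basis α (h * g)) := by
      rw [← map_mul, basis_mul_basis, map_smul]
    have h2 : ρ (basis α h) = (α.1 h g : F) • (ρ (basis α (h * g)) * v g) := by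
      rw [← smul_mul_assoc, ← h1, mul_assoc, huv, mul_one]
    rw [h2, Matrix.mul_smul, ← mul_assoc, hvu, one_mul]
  have hcomm : ∀ y, Commute (ρ y) (∑ g, ρ (basis α g) * x * v g) := by
    intro y
    induction y using induction_on with
    | h0 => rw [map_zero]; exact Commute.zero_left _
    | hadd y z hy hz => rw [map_add]; exact hy.add_left hz
    | hs h a =>
      rw [map_smul]
      refine Commute.smul_left ?_ a
      rw [Commute, SemiconjBy, Finset.mul_sum, Finset.sum_mul]
      refine Fintype.sum_equiv (Equiv.mulLeft h) _ _ fun g => ?_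
      rw [Equiv.coe_mulLeft, mul_assoc _ (v (h * g)), hv, ← mul_assoc, ← mul_assoc, ← map_mul,
        basis_mul_basis, map_smul, smul_mul_assoc, smul_mul_assoc, Matrix.mul_smul]
  obtain ⟨c, hc⟩ := Matrix.mem_range_scalar_iff_commute_single'.2 fun i j => by
    obtain ⟨y, hy⟩ := hρ (Matrix.single i j 1)
    exact hy ▸ hcomm y
  refine ⟨c, hc.symm, ?_⟩
  have htr := congrArg Matrix.trace hc
  rw [Matrix.trace_sum] at htr
  simp only [fun g => Matrix.trace_mul_cycle (ρ (basis α g)) x (v g), hvu, one_mul,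
    Finset.sum_const, Finset.card_univ, nsmul_eq_mul] at htr
  rw [← htr]
  simp [Matrix.trace, Matrix.scalar_apply]

open scoped Kronecker in
/-- The degree of an irreducible projective representation of a finite group with cocycle valued in
the roots of unity divides the order of the group. -/
theorem card_dvd_of_surjective [CharZero F] [Finite G] [Nonempty m] (α : twoCocycles F G)
    (hα : ∀ g h, α.1 g h ^ Nat.card G = 1) (ρ : TwistedGroupRing α →ₐ[F] Matrix m m F)
    (hρ : Function.Surjective ρ) : Fintype.card m ∣ Nat.card G := by
  have := Fintype.ofFinite G
  set n := Nat.card G with hn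
  have : NeZero n := ⟨Nat.card_pos.ne'⟩
  let u : G → Matrix m m F := fun g => ρ (basis α g)
  -- Closure under multiplication and finiteness both rest on the values of `α` being `n`-th roots
  -- of unity.
  let T : Submonoid (Matrix m m F) :=
    { carrier := Set.range fun p : rootsOfUnity n F × G => ((p.1 : Fˣ) : F) • u p.2
      one_mem' := by
        refine ⟨(⟨(α.1 1 1)⁻¹, ?_⟩, 1), ?_⟩
        · rw [mem_rootsOfUnity, inv_pow, hα, inv_one]
        · change (((α.1 1 1)⁻¹ : Fˣ) : F) • ρ (basis α 1) = 1
          rw [← map_smul, ← one_def, map_one]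
      mul_mem' := by
        rintro _ _ ⟨⟨a, g⟩, rfl⟩ ⟨⟨b, h⟩, rfl⟩
        refine ⟨(a * b * ⟨α.1 g h, by rw [mem_rootsOfUnity, hα]⟩, g * h), ?_⟩
        simp only [u]
        rw [← map_smul ρ, ← map_smul ρ, ← map_smul ρ, ← map_mul ρ, smul_basis_mul_smul_basis]
        simp }
  have hTfin : (T : Set (Matrix m m F)).Finite := Set.finite_range _
  have huT : ∀ g, u g ∈ T := fun g => ⟨(1, g), by simp⟩
  have hv : ∀ g, ∃ v ∈ T, u g * v = 1 := by
    intro g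
    refine ⟨(((α.1 g g⁻¹ * α.1 1 1)⁻¹ : Fˣ) : F) • u g⁻¹,
      ⟨(⟨(α.1 g g⁻¹ * α.1 1 1)⁻¹, ?_⟩, g⁻¹), rfl⟩, ?_⟩
    · rw [mem_rootsOfUnity, inv_pow, mul_pow, hα, hα, one_mul, inv_one]
    · simp only [u]
      rw [Matrix.mul_smul, ← map_mul, basis_mul_basis, mul_inv_cancel, basis_one, smul_smul,
        ← Units.val_mul, map_smul, map_one, smul_smul, ← Units.val_mul, inv_mul_cancel,
        Units.val_one, one_smul]
  choose v hvT huv using hv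
  let K : Submonoid (Matrix (m × m) (m × m) F) :=
    { carrier := Set.image2 (fun A B => A ⊗ₖ B) T T
      one_mem' := ⟨1, T.one_mem, 1, T.one_mem, Matrix.one_kronecker_one⟩
      mul_mem' := by
        rintro _ _ ⟨A, hA, B, hB, rfl⟩ ⟨A', hA', B', hB', rfl⟩
        exact ⟨A * A', T.mul_mem hA hA', B * B', T.mul_mem hB hB', Matrix.mul_kronecker_mul ..⟩ }
  have hKfin : (K : Set (Matrix (m × m) (m × m) F)).Finite := hTfin.image2 _ hTfin
  -- This is a Casimir-type element: integral as a sum over a finite monoid, and equal to `q = |G| /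
  -- |m|` times the flip of the two tensor factors. Hence `C ^ 2 = q ^ 2`, so the rational number
  -- `q` is integral and therefore an integer.
  let C : Matrix (m × m) (m × m) F := ∑ g, u g ⊗ₖ v g
  have hCint : IsIntegral ℤ C := IsIntegral.of_mem_span_of_finite K hKfin <|
    sum_mem fun g _ => Submodule.subset_span ⟨u g, huT g, v g, hvT g, rfl⟩
  set q : F := (n : F) / Fintype.card m with hq
  have hm : (Fintype.card m : F) ≠ 0 := Nat.cast_ne_zero.2 Fintype.card_ne_zero
  have hC : ∀ i l k j, C (i, l) (k, j) = if i = j ∧ k = l then q else 0 := by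
    intro i l k j
    -- Averaging the matrix unit at `(k, l)` produces exactly the entries of `C` with these `k` and
    -- `l`.
    obtain ⟨c, hc, hc'⟩ := exists_sum_conj_eq_scalar α ρ hρ v huv (Matrix.single k l 1)
    have h1 : C (i, l) (k, j) =
        (∑ g, ρ (basis α g) * Matrix.single k l 1 * v g : Matrix m m F) i j := by
      simp only [C, Matrix.sum_apply, Matrix.kroneckerMap_apply]
      refine Finset.sum_congr rfl fun g _ => ?_
      rw [Matrix.mul_apply, Finset.sum_eq_single l]
      · simp [u]
      · intro b _ hb
        rw [Matrix.mul_single_apply_of_ne _ _ _ _ _ hb, zero_mul]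
      · simp
    rw [h1, hc, Matrix.scalar_apply, Matrix.diagonal_apply]
    rw [← Nat.card_eq_fintype_card (α := G), ← hn] at hc'
    by_cases hkl : k = l
    · subst hkl
      rw [Matrix.trace_single_eq_same, mul_one] at hc'
      have : c = q := by rw [hq, ← hc', mul_div_cancel_left₀ _ hm]
      simp [this]
    · rw [Matrix.trace_single_eq_of_ne k l 1 hkl, mul_zero] at hc'
      have : c = 0 := (mul_eq_zero.1 hc').resolve_left hm
      simp [this, hkl]
  have hCC : C ^ 2 = algebraMap F _ (q ^ 2) := by
    ext ⟨i, l⟩ ⟨k, j⟩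
    rw [pow_two, Matrix.mul_apply, Finset.sum_eq_single (l, i), hC, hC,
      Matrix.algebraMap_matrix_apply]
    · by_cases h1 : i = k <;> by_cases h2 : l = j <;> simp [h1, h2, sq, eq_comm]
    · rintro ⟨a, b⟩ _ hab
      rw [hC, if_neg, zero_mul]
      rintro ⟨rfl, rfl⟩
      exact hab rfl
    · simp
  have hqint : IsIntegral ℤ q := by
    refine IsIntegral.of_pow two_pos ?_
    rw [← isIntegral_algebraMap_iff (B := Matrix (m × m) (m × m) F)
      (FaithfulSMul.algebraMap_injective F _), ← hCC]
    exact hCint.pow 2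
  obtain ⟨k, hk⟩ := hqint.exists_int_iff_exists_rat.1 ⟨(n : ℚ) / Fintype.card m, by simp [hq]⟩
  rw [hq, div_eq_iff hm] at hk
  rw [← Int.natCast_dvd_natCast]
  refine ⟨k, ?_⟩
  rw [mul_comm]
  exact_mod_cast hk

/-- The degrees of the irreducible projective representations of a finite group divide its
order. -/
theorem HasDegrees.dvd_card [IsAlgClosed F] [CharZero F] [Finite G] {α : twoCocycles F G}
    {ι : Type*} {d : ι → ℕ} (h : HasDegrees α d) (i : ι) : d i ∣ Nat.card G := by
  classical
  obtain ⟨β, hαβ, hβ⟩ := twoCocycles.exists_pow_card_eq_one α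
  obtain ⟨f⟩ := nonempty_algEquiv_of_cohomologyClass_eq hαβ.symm
  obtain ⟨hd, ⟨e⟩⟩ := h.of_algEquiv f
  have : NeZero (d i) := ⟨hd i⟩
  let ρ : TwistedGroupRing β →ₐ[F] Matrix (Fin (d i)) (Fin (d i)) F :=
    (Pi.evalAlgHom F (fun i => Matrix (Fin (d i)) (Fin (d i)) F) i).comp e.toAlgHom
  have hρ : Function.Surjective ρ := fun x => ⟨e.symm (Pi.single i x), by simp [ρ]⟩
  simpa using card_dvd_of_surjective β hβ ρ hρ

end TwistedGroupRing

/-! ### Recovering a factor from a coprime product -/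

/-- The second component of the image is killed by both `m` and `n`. -/
theorem prod_mulEquiv_apply_mk_one {X Y X' Y' : Type*} [Group X] [Group Y] [Group X']
    [Group Y'] {m n : ℕ} (hmn : m.Coprime n) (hX : ∀ x : X, x ^ m = 1) (hY' : ∀ y : Y', y ^ n = 1)
    (θ : X × Y ≃* X' × Y') (x : X) : θ (x, 1) = ((θ (x, 1)).1, 1) := by
  refine Prod.ext rfl ?_
  have h1 : (θ (x, 1)).2 ^ m = 1 := by
    rw [← Prod.pow_snd, ← map_pow, Prod.pow_mk, hX, one_pow]
    exact congrArg Prod.snd (map_one θ)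
  have h2 := pow_gcd_eq_one.2 ⟨h1, hY' (θ (x, 1)).2⟩
  rwa [hmn.gcd_eq_one, pow_one] at h2

theorem exists_mulEquiv_of_prod_mulEquiv {X Y X' Y' : Type*} [Group X] [Group Y] [Group X']
    [Group Y'] {m n : ℕ} (hmn : m.Coprime n) (hX : ∀ x : X, x ^ m = 1) (hX' : ∀ x : X', x ^ m = 1)
    (hY : ∀ y : Y, y ^ n = 1) (hY' : ∀ y : Y', y ^ n = 1) (θ : X × Y ≃* X' × Y') :
    ∃ φ : X ≃* X', ∀ x, θ (x, 1) = (φ x, 1) := by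
  have h1 := prod_mulEquiv_apply_mk_one hmn hX hY' θ
  have h2 := prod_mulEquiv_apply_mk_one hmn hX' hY θ.symm
  refine ⟨{ toFun := fun x => (θ (x, 1)).1
            invFun := fun x => (θ.symm (x, 1)).1
            left_inv := fun x => ?_
            right_inv := fun x => ?_
            map_mul' := fun x y => ?_ }, h1⟩
  · change (θ.symm ((θ (x, 1)).1, 1)).1 = x
    rw [← h1, MulEquiv.symm_apply_apply]
  · change (θ ((θ.symm (x, 1)).1, 1)).1 = x
    rw [← h2, MulEquiv.apply_symm_apply]
  · rw [← Prod.fst_mul, ← map_mul, Prod.mk_mul_mk, one_mul]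

/-- The gcd with `k` recovers the first factor of each product, so `σ` preserves it. Each value then
occurs with multiplicity scaled by the number of second indices. The sums of squares show that this
number is the same on both sides, and it can be cancelled. -/
theorem exists_equiv_of_prod_degrees {ι κ ι' κ' : Type*} [Fintype ι] [Fintype κ] [Fintype ι']
    [Fintype κ'] [Nonempty κ] {d : ι → ℕ} {e : κ → ℕ} {d' : ι' → ℕ} {e' : κ' → ℕ} {k l : ℕ}
    (hkl : k.Coprime l) (hk : k ≠ 0) (hd : ∀ i, d i ∣ k) (he : ∀ j, e j ∣ l)
    (hd' : ∀ i, d' i ∣ k) (he' : ∀ j, e' j ∣ l) (hsum : ∑ i, d i ^ 2 = k)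
    (hsum' : ∑ i, d' i ^ 2 = k) (σ : ι × κ ≃ ι' × κ')
    (hσ : ∀ p, d' (σ p).1 * e' (σ p).2 = d p.1 * e p.2) :
    ∃ τ : ι ≃ ι', ∀ i, d' (τ i) = d i := by
  classical
  have hgcd : ∀ {a b : ℕ}, a ∣ k → b ∣ l → (a * b).gcd k = a := fun {a b} ha hb => by
    rw [Nat.Coprime.gcd_mul_right_cancel a (hkl.symm.coprime_dvd_left hb), Nat.gcd_eq_left ha]
  have hσ1 : ∀ p, d' (σ p).1 = d p.1 := fun p => by
    rw [← hgcd (hd p.1) (he p.2), ← hσ, hgcd (hd' _) (he' _)]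
  have hcard : Fintype.card κ = Fintype.card κ' := by
    have h1 : ∑ p : ι × κ, d p.1 ^ 2 = ∑ p : ι' × κ', d' p.1 ^ 2 :=
      Fintype.sum_equiv σ _ _ fun p => by rw [hσ1]
    simp only [Fintype.sum_prod_type, Finset.sum_const, Finset.card_univ, smul_eq_mul,
      ← Finset.mul_sum, hsum, hsum'] at h1
    exact Nat.eq_of_mul_eq_mul_right (Nat.pos_of_ne_zero hk) h1
  have hfib : ∀ c, Fintype.card {i // d i = c} = Fintype.card {i // d' i = c} := by
    intro c
    have h1 : Fintype.card {p : ι × κ // d p.1 = c} = Fintype.card {p : ι' × κ' // d' p.1 = c} :=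
      Fintype.card_congr (σ.subtypeEquiv fun p => by rw [hσ1])
    rw [Fintype.card_congr (Equiv.prodSubtypeFstEquivSubtypeProd (p := fun i => d i = c)),
      Fintype.card_congr (Equiv.prodSubtypeFstEquivSubtypeProd (p := fun i => d' i = c)),
      Fintype.card_prod, Fintype.card_prod, ← hcard] at h1
    exact Nat.eq_of_mul_eq_mul_right Fintype.card_pos h1
  refine ⟨Equiv.ofFiberEquiv fun c => Fintype.equivOfCardEq (hfib c), fun i => ?_⟩
  exact Equiv.ofFiberEquiv_map _ i

/-! ### The relation on products of coprime orders -/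

section Coprime

open TwistedGroupRing

variable {F : Type*} [Field F] [IsAlgClosed F] [CharZero F]

theorem TwistedGroupRing.nonempty_algEquiv_prod {G H G' H' : Type*} [Group G] [Group H] [Group G']
    [Group H'] [Finite G] [Finite H] [Finite G'] [Finite H'] {α : twoCocycles F G}
    {β : twoCocycles F H} {α' : twoCocycles F G'} {β' : twoCocycles F H'}
    (f : TwistedGroupRing α ≃+* TwistedGroupRing α')
    (g : TwistedGroupRing β ≃+* TwistedGroupRing β') :
    Nonempty (TwistedGroupRing (twoCocycles.prod α β) ≃ₐ[F]
      TwistedGroupRing (twoCocycles.prod α' β')) := by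
  obtain ⟨f⟩ := nonempty_algEquiv_of_ringEquiv f
  obtain ⟨g⟩ := nonempty_algEquiv_of_ringEquiv g
  obtain ⟨m, d, hd⟩ := exists_hasDegrees α
  obtain ⟨n, e, he⟩ := exists_hasDegrees β
  exact (hd.prod he).nonempty_algEquiv ((hd.of_algEquiv f.symm).prod (he.of_algEquiv g.symm))
    (Equiv.refl _) fun _ => rfl

theorem TwistedGroupRing.nonempty_ringEquiv_of_prod {G H G' H' : Type*} [Group G] [Group H]
    [Group G'] [Group H'] [Finite G] [Finite H] [Finite G'] [Finite H']
    (hG : Nat.card G = Nat.card G') (hH : Nat.card H = Nat.card H')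
    (hc : (Nat.card G).Coprime (Nat.card H)) {α : twoCocycles F G}
    {β : twoCocycles F H} {α' : twoCocycles F G'} {β' : twoCocycles F H'}
    (f : TwistedGroupRing (twoCocycles.prod α β) ≃+* TwistedGroupRing (twoCocycles.prod α' β')) :
    Nonempty (TwistedGroupRing α ≃+* TwistedGroupRing α') := by
  obtain ⟨m, d, hd⟩ := exists_hasDegrees α
  obtain ⟨n, e, he⟩ := exists_hasDegrees β
  obtain ⟨m', d', hd'⟩ := exists_hasDegrees α'
  obtain ⟨n', e', he'⟩ := exists_hasDegrees β'
  obtain ⟨σ, hσ⟩ := (hd.prod he).exists_equiv (hd'.prod he') f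
  -- With no degrees the sum of squares would be `0`, not `|H|`.
  have : Nonempty (Fin n) := by
    by_contra hn
    have := not_nonempty_iff.1 hn
    have h1 := he.sum_sq
    rw [Fintype.sum_empty] at h1
    exact Nat.card_pos.ne h1
  obtain ⟨τ, hτ⟩ := exists_equiv_of_prod_degrees hc Nat.card_pos.ne' hd.dvd_card he.dvd_card
    (fun i => hG ▸ hd'.dvd_card i) (fun i => hH ▸ he'.dvd_card i) hd.sum_sq
    (hd'.sum_sq.trans hG.symm) σ hσ
  obtain ⟨a⟩ := hd.nonempty_algEquiv hd' τ hτ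
  exact ⟨a.toRingEquiv⟩

theorem TwistedEquiv.prod {G H G' H' : Type*} [Group G] [Group H] [Group G'] [Group H'] [Finite G]
    [Finite H] [Finite G'] [Finite H'] (hG : Nat.card G = Nat.card G')
    (hH : Nat.card H = Nat.card H') (hc : (Nat.card G).Coprime (Nat.card H))
    (h : TwistedEquiv F G G') (h' : TwistedEquiv F H H') :
    TwistedEquiv F (G × H) (G' × H') := by
  obtain ⟨φ, hφ⟩ := h
  obtain ⟨ψ, hψ⟩ := h'
  have hc' : (Nat.card G').Coprime (Nat.card H') := hG ▸ hH ▸ hc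
  let Ψ := SecondCohomology.prodEquiv F hc
  let Ψ' := SecondCohomology.prodEquiv F hc'
  refine ⟨(Ψ.symm.trans (φ.prodCongr ψ)).trans Ψ', fun γ γ' hγ => ?_⟩
  obtain ⟨⟨a, b⟩, hab⟩ := Ψ.surjective (cohomologyClass γ)
  obtain ⟨α, rfl⟩ := cohomologyClass_surjective a
  obtain ⟨β, rfl⟩ := cohomologyClass_surjective b
  obtain ⟨α', hα'⟩ := cohomologyClass_surjective (φ (cohomologyClass α))
  obtain ⟨β', hβ'⟩ := cohomologyClass_surjective (ψ (cohomologyClass β))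
  rw [← hab] at hγ
  simp only [MulEquiv.trans_apply, MulEquiv.symm_apply_apply] at hγ
  have hγ' : cohomologyClass γ' = cohomologyClass (twoCocycles.prod α' β') := by
    rw [hγ, ← SecondCohomology.prodEquiv_cohomologyClass hc', hα', hβ']
    rfl
  obtain ⟨f⟩ := hφ α α' hα'
  obtain ⟨g⟩ := hψ β β' hβ'
  obtain ⟨t⟩ := nonempty_algEquiv_prod f g
  obtain ⟨s⟩ := nonempty_algEquiv_of_cohomologyClass_eq (β := twoCocycles.prod α β) hab.symm
  obtain ⟨s'⟩ := nonempty_algEquiv_of_cohomologyClass_eq hγ'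
  exact ⟨((s.trans t).trans s'.symm).toRingEquiv⟩

theorem TwistedEquiv.fst_of_prod {G H G' H' : Type*} [Group G] [Group H] [Group G'] [Group H']
    [Finite G] [Finite H] [Finite G'] [Finite H'] (hG : Nat.card G = Nat.card G')
    (hH : Nat.card H = Nat.card H') (hc : (Nat.card G).Coprime (Nat.card H))
    (h : TwistedEquiv F (G × H) (G' × H')) : TwistedEquiv F G G' := by
  obtain ⟨θ, hθ⟩ := h
  have hc' : (Nat.card G').Coprime (Nat.card H') := hG ▸ hH ▸ hc
  let Ψ := SecondCohomology.prodEquiv F hc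
  let Ψ' := SecondCohomology.prodEquiv F hc'
  obtain ⟨φ, hφ⟩ := exists_mulEquiv_of_prod_mulEquiv hc SecondCohomology.pow_card_eq_one
    (fun x => hG ▸ SecondCohomology.pow_card_eq_one x) SecondCohomology.pow_card_eq_one
    (fun x => hH ▸ SecondCohomology.pow_card_eq_one x) ((Ψ.trans θ).trans Ψ'.symm)
  refine ⟨φ, fun α α' hα => ?_⟩
  -- The trivial cocycle on the second factor places the class in `H²(G)`, which the isomorphism
  -- carries into `H²(G')`.
  obtain ⟨f⟩ := hθ (twoCocycles.prod α 1) (twoCocycles.prod α' 1) (by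
    rw [← SecondCohomology.prodEquiv_cohomologyClass hc,
      ← SecondCohomology.prodEquiv_cohomologyClass hc', hα]
    exact (Ψ'.symm_apply_eq.1 (hφ (cohomologyClass α))).symm)
  exact nonempty_ringEquiv_of_prod hG hH hc f

/-- For direct products of two groups of coprime orders, the relation can be checked on the
factors. -/
theorem TwistedEquiv.prod_iff {G H G' H' : Type*} [Group G] [Group H] [Group G'] [Group H']
    [Finite G] [Finite H] [Finite G'] [Finite H'] (hG : Nat.card G = Nat.card G')
    (hH : Nat.card H = Nat.card H') (hc : (Nat.card G).Coprime (Nat.card H)) :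
    TwistedEquiv F (G × H) (G' × H') ↔ TwistedEquiv F G G' ∧ TwistedEquiv F H H' :=
  ⟨fun h => ⟨h.fst_of_prod hG hH hc,
    ((TwistedEquiv.congr MulEquiv.prodComm MulEquiv.prodComm).1 h).fst_of_prod hH hG hc.symm⟩,
    fun h => h.1.prod hG hH hc h.2⟩

/-- Splitting off the first factor of a finite direct product. -/
def MulEquiv.piFinSucc {r : ℕ} (G : Fin (r + 1) → Type*) [∀ i, Mul (G i)] :
    (∀ i, G i) ≃* G 0 × ∀ i : Fin r, G i.succ :=
  { (Fin.consEquiv G).symm with map_mul' := fun _ _ => rfl }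

/-- Reindexing a direct product. -/
def MulEquiv.piReindex {ι κ : Type*} (G : ι → Type*) [∀ i, Mul (G i)] (σ : ι ≃ κ) :
    (∀ i, G i) ≃* ∀ j, G (σ.symm j) :=
  { Equiv.piCongrLeft' G σ with map_mul' := fun _ _ => rfl }

theorem TwistedEquiv.pi_fin_iff (r : ℕ) (G H : Fin r → Type*) [∀ i, Group (G i)]
    [∀ i, Group (H i)] [∀ i, Finite (G i)] [∀ i, Finite (H i)]
    (hcard : ∀ i, Nat.card (G i) = Nat.card (H i))
    (hc : ∀ i j, i ≠ j → (Nat.card (G i)).Coprime (Nat.card (G j))) :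
    TwistedEquiv F (∀ i, G i) (∀ i, H i) ↔ ∀ i, TwistedEquiv F (G i) (H i) := by
  induction r with
  | zero => exact iff_of_true (TwistedEquiv.of_mulEquiv F MulEquiv.ofUnique) fun i => i.elim0
  | succ r ih =>
    rw [TwistedEquiv.congr (MulEquiv.piFinSucc G) (MulEquiv.piFinSucc H),
      TwistedEquiv.prod_iff (hcard 0), ih, Fin.forall_fin_succ]
    · exact fun i => hcard i.succ
    · exact fun i j hij => hc _ _ fun h => hij (Fin.succ_injective _ h)
    · rw [Nat.card_pi, Nat.card_pi]
      exact Finset.prod_congr rfl fun i _ => hcard i.succ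
    · rw [Nat.card_pi]
      exact Nat.Coprime.prod_right fun i _ => hc _ _ (Fin.succ_ne_zero i).symm

/-- For finite direct products of groups of pairwise coprime orders, the relation can be checked on
the factors. -/
theorem TwistedEquiv.pi_iff {ι : Type*} [Finite ι] (G H : ι → Type*) [∀ i, Group (G i)]
    [∀ i, Group (H i)] [∀ i, Finite (G i)] [∀ i, Finite (H i)]
    (hcard : ∀ i, Nat.card (G i) = Nat.card (H i))
    (hc : ∀ i j, i ≠ j → (Nat.card (G i)).Coprime (Nat.card (G j))) :
    TwistedEquiv F (∀ i, G i) (∀ i, H i) ↔ ∀ i, TwistedEquiv F (G i) (H i) := by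
  obtain ⟨r, ⟨σ⟩⟩ := Finite.exists_equiv_fin ι
  rw [TwistedEquiv.congr (MulEquiv.piReindex G σ) (MulEquiv.piReindex H σ),
    TwistedEquiv.pi_fin_iff r _ _ (fun j => hcard _)
    fun i j hij => hc _ _ fun h => hij (σ.symm.injective h)]
  exact σ.symm.forall_congr_right (q := fun i => TwistedEquiv F (G i) (H i))

end Coprime

/-! ### Nilpotent groups and Sylow subgroups -/

section Nilpotent

theorem Sylow.subsingleton_of_isNilpotent {G : Type*} [Group G] [Finite G] [Group.IsNilpotent G]
    (p : ℕ) [hp : Fact p.Prime] : Subsingleton (Sylow p G) := by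
  have hn := ((Group.isNilpotent_of_finite_tfae (G := G)).out 0 3).1 ‹_›
  have := Sylow.unique_of_normal (default : Sylow p G) (hn p hp default)
  infer_instance

/-- A finite nilpotent group is the direct product of any choice of its Sylow subgroups. -/
theorem Group.IsNilpotent.nonempty_mulEquiv_pi_sylow {G : Type*} [Group G] [Finite G]
    [Group.IsNilpotent G] (P : ∀ p : (Nat.card G).primeFactors, Sylow (p : ℕ) G) :
    Nonempty (G ≃* ∀ p, P p) := by
  obtain ⟨e⟩ := ((Group.isNilpotent_of_finite_tfae (G := G)).out 0 4).1 ‹_›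
  refine ⟨e.symm.trans (MulEquiv.piCongrRight fun p => ?_)⟩
  have : Fact (p : ℕ).Prime := ⟨Nat.prime_of_mem_primeFactors p.2⟩
  have := Sylow.subsingleton_of_isNilpotent (G := G) p
  let _ : Unique (Sylow (p : ℕ) G) := uniqueOfSubsingleton (P p)
  exact MulEquiv.piUnique fun Q : Sylow (p : ℕ) G => (Q : Subgroup G)

/-- For finite nilpotent groups of the same order, the relation can be checked on the Sylow
subgroups. -/
theorem TwistedEquiv.iff_sylow {F : Type*} [Field F] [IsAlgClosed F] [CharZero F] {G H : Type*}
    [Group G] [Group H] [Finite G] [Finite H] [Group.IsNilpotent G] [Group.IsNilpotent H]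
    (hcard : Nat.card G = Nat.card H) :
    TwistedEquiv F G H ↔
      ∀ (p : ℕ) [Fact p.Prime] (P : Sylow p G) (Q : Sylow p H), TwistedEquiv F P Q := by
  have hPQ : ∀ (p : ℕ) [Fact p.Prime] (P : Sylow p G) (Q : Sylow p H),
      Nat.card P = Nat.card Q := fun p _ P Q => by
    rw [P.card_eq_multiplicity, Q.card_eq_multiplicity, hcard]
  have hprime : ∀ p : (Nat.card G).primeFactors, Fact (p : ℕ).Prime :=
    fun p => ⟨Nat.prime_of_mem_primeFactors p.2⟩
  have key : ∀ (P : ∀ p : (Nat.card G).primeFactors, Sylow (p : ℕ) G)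
      (Q : ∀ p : (Nat.card G).primeFactors, Sylow (p : ℕ) H),
      TwistedEquiv F G H ↔ ∀ p, TwistedEquiv F (P p) (Q p) := by
    intro P Q
    obtain ⟨e⟩ := Group.IsNilpotent.nonempty_mulEquiv_pi_sylow P
    -- The index set is a variable so that the Sylow subgroups of `H` can be indexed by the primes
    -- dividing `|G|`.
    have hH : ∀ s (_ : s = (Nat.card H).primeFactors) (Q : ∀ p : s, Sylow (p : ℕ) H),
        Nonempty (H ≃* ∀ p, Q p) := by
      rintro _ rfl Q
      exact Group.IsNilpotent.nonempty_mulEquiv_pi_sylow Q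
    obtain ⟨e'⟩ := hH _ (by rw [hcard]) Q
    rw [TwistedEquiv.congr e e']
    refine TwistedEquiv.pi_iff _ _ (fun p => hPQ p _ _) fun p q hpq => ?_
    change (Nat.card (P p : Subgroup G)).Coprime (Nat.card (P q : Subgroup G))
    rw [(P p).card_eq_multiplicity, (P q).card_eq_multiplicity]
    exact Nat.coprime_pow_primes _ _ (hprime p).out (hprime q).out fun h => hpq (Subtype.ext h)
  constructor
  · intro h p hp P Q
    by_cases hpG : p ∈ (Nat.card G).primeFactors
    · have := Sylow.subsingleton_of_isNilpotent (G := G) p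
      have := Sylow.subsingleton_of_isNilpotent (G := H) p
      rw [Subsingleton.elim P default, Subsingleton.elim Q default]
      exact (key (fun _ => default) fun _ => default).1 h ⟨p, hpG⟩
    -- For a prime not dividing the order, both Sylow subgroups are trivial.
    · have hP : Nat.card P = 1 := by
        rw [P.card_eq_multiplicity, ← Nat.support_factorization, Finsupp.notMem_support_iff] at *
        rw [hpG, pow_zero]
      have hQ : Nat.card Q = 1 := (hPQ p P Q).symm.trans hP
      have := (Nat.card_eq_one_iff_unique.1 hP).1
      have := (Nat.card_eq_one_iff_unique.1 hQ).1
      let _ : Unique P := uniqueOfSubsingleton 1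
      let _ : Unique Q := uniqueOfSubsingleton 1
      exact TwistedEquiv.of_mulEquiv F MulEquiv.ofUnique
  · exact fun h => (key (fun _ => default) fun _ => default).2 fun p => h p _ _

end Nilpotent

end

theorem theorem1p3 :
    (∀ (r : ℕ) (G : Fin r → Type*) (H : Fin r → Type*)
      [∀ i, Group (G i)] [∀ i, Group (H i)] [∀ i, Finite (G i)] [∀ i, Finite (H i)]
      (k : Fin r → ℕ),
      (∀ i, Nat.card (G i) = k i) → (∀ i, Nat.card (H i) = k i) →
      (∀ i j, i ≠ j → Nat.Coprime (k i) (k j)) →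
        (TwistedEquiv ℂ (∀ i, G i) (∀ i, H i) ↔ ∀ i, TwistedEquiv ℂ (G i) (H i))) ∧
    (∀ (G : Type*) (H : Type*) [Group G] [Group H] [Finite G] [Finite H]
      [Group.IsNilpotent G] [Group.IsNilpotent H],
      Nat.card G = Nat.card H →
        (TwistedEquiv ℂ G H ↔
          ∀ (p : ℕ) [Fact p.Prime] (P : Sylow p G) (Q : Sylow p H), TwistedEquiv ℂ P Q)) := by
  refine ⟨fun r G H _ _ _ _ k hG hH hk => ?_, fun G H _ _ _ _ _ _ hcard => ?_⟩
  · refine TwistedEquiv.pi_fin_iff r G H (fun i => (hG i).trans (hH i).symm) fun i j hij => ?_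
    rw [hG, hG]
    exact hk i j hij
  · exact TwistedEquiv.iff_sylow hcard
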